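/- Let $q$ be a prime power, let $n\ge 3$ and $0\le d\le q$ be integers, and let $H=(h_{ij})_{0\le i,j\le n}$ be a Hermitian matrix over $\mathbb F_{q^2}$, that is, $H\neq 0$ and $h_{ij}=h_{ji}^{\,q}$ for all $i,j$. Suppose that $H$ has rank $n$, and let $P\mathcal U_{n-1}\subset\mathbb P^n$ be the degenerate Hermitian variety of rank $n$ defined by $$\sum_{i,j=0}^{n} h_{ij}\,x_i\,x_j^{\,q}=0 .$$ Let $\mathbb F_{q^2}[x_0,\dots,x_n]_d$ be the space of homogeneous polynomials of degree $d$ over $\mathbb F_{q^2}$ together with $0$, and represent each point $\mathsf P\in P\mathcal U_{n-1}(\mathbb F_{q^2})$ by its homogeneous coordinate vector whose last non-zero coordinate is $1$. Then the linear evaluation map $$\mathrm{ev}:\mathbb F_{q^2}[x_0,\dots,x_n]_d\to \mathbb F_{q^2}^{\,P\mathcal U_{n-1}(\mathbb F_{q^2})},\qquad F\mapsto \bigl(F(\mathsf P)\bigr)_{\mathsf P\in P\mathcal U_{n-1}(\mathbb F_{q^2})},$$ is injective. In particular, for every non-zero $F\in\mathbb F_{q^2}[x_0,\dots,x_n]_d$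 there is a point of $P\mathcal U_{n-1}(\mathbb F_{q^2})$ at which $F$ does not vanish. -/

import Mathlib

namespace HermitianCode

variable {K : Type*} [Field K]

/-- Hermitian matrices over the field with `q ^ 2` elements: `H ≠ 0` and `Hᵀ = H^(q)`, where
`H^(q)` is obtained from `H` by raising every entry to the `q`-th power. -/
def IsHermitianMatrix {n : ℕ} (q : ℕ) (H : Matrix (Fin (n + 1)) (Fin (n + 1)) K) : Prop :=
  H ≠ 0 ∧ H.transpose = H.map (fun a => a ^ q)

/-- The polynomial `xᵀ H x^(q) = ∑ i j, h_ij x_i x_j ^ q`. -/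
noncomputable def hermitianPoly {n : ℕ} (q : ℕ) (H : Matrix (Fin (n + 1)) (Fin (n + 1)) K) :
    MvPolynomial (Fin (n + 1)) K :=
  ∑ i, ∑ j, MvPolynomial.C (H i j) * MvPolynomial.X i * MvPolynomial.X j ^ q

/-- `F` vanishes at the rational point `P` of projective space: it vanishes at every vector of
homogeneous coordinates of `P`. -/
def VanishesAt {n : ℕ} (F : MvPolynomial (Fin (n + 1)) K)
    (P : Projectivization K (Fin (n + 1) → K)) : Prop :=
  ∀ (v : Fin (n + 1) → K) (hv : v ≠ 0), Projectivization.mk K v hv = P → MvPolynomial.eval v F = 0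

/-- The set of `K`-rational points of the Hermitian variety defined by `H`. -/
def hermitianPoints {n : ℕ} (q : ℕ) (H : Matrix (Fin (n + 1)) (Fin (n + 1)) K) :
    Set (Projectivization K (Fin (n + 1) → K)) :=
  {P | VanishesAt (hermitianPoly q H) P}

/-- The last non-zero coordinate of `v` is `1`. -/
def IsNormalized {n : ℕ} (v : Fin (n + 1) → K) : Prop :=
  ∃ i, v i = 1 ∧ ∀ j, i < j → v j = 0

theorem IsNormalized.ne_zero {n : ℕ} {v : Fin (n + 1) → K} (h : IsNormalized v) : v ≠ 0 := by
  obtain ⟨i, hi, -⟩ := h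
  rintro rfl
  simp at hi

theorem existsUnique_normalized {n : ℕ} (P : Projectivization K (Fin (n + 1) → K)) :
    ∃! v : Fin (n + 1) → K, IsNormalized v ∧ ∃ hv : v ≠ 0, Projectivization.mk K v hv = P := by
  classical
  induction P using Projectivization.ind with
  | h w hw =>
    have hne : (Finset.univ.filter (fun i => w i ≠ 0)).Nonempty := by
      obtain ⟨i, hi⟩ := Function.ne_iff.mp hw
      exact ⟨i, by simpa using hi⟩
    set m := (Finset.univ.filter (fun i => w i ≠ 0)).max' hne with hm
    have hwm : w m ≠ 0 := by
      have := Finset.max'_mem _ hne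
      simpa using this
    have hgt : ∀ j, m < j → w j = 0 := by
      intro j hj
      by_contra h
      exact absurd (Finset.le_max' _ j (by simpa using h)) (not_le.mpr hj)
    have hN : IsNormalized ((w m)⁻¹ • w) :=
      ⟨m, by simp [hwm], fun j hj => by simp [hgt j hj]⟩
    refine ⟨(w m)⁻¹ • w, ⟨hN, hN.ne_zero, ?_⟩, ?_⟩
    · rw [Projectivization.mk_eq_mk_iff']
      exact ⟨(w m)⁻¹, rfl⟩
    · rintro v ⟨⟨i, hi, hj⟩, hv, hP⟩
      rw [Projectivization.mk_eq_mk_iff'] at hP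
      obtain ⟨a, rfl⟩ := hP
      have ha : a ≠ 0 := by
        rintro rfl
        simp at hv
      have him : i = m := by
        rcases lt_trichotomy i m with h | h | h
        · have := hj m h
          simp [ha, hwm] at this
        · exact h
        · simp [hgt i h] at hi
      subst him
      have : a = (w m)⁻¹ := eq_inv_of_mul_eq_one_left (by simpa using hi)
      rw [this]

/-- The vector of homogeneous coordinates of `P` whose last non-zero coordinate is `1`. -/
noncomputable def normRep {n : ℕ} (P : Projectivization K (Fin (n + 1) → K)) : Fin (n + 1) → K :=
  (existsUnique_normalized P).choose

/-- Evaluation of the forms of degree `d` (together with `0`) at the normalized coordinate vectors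
of the points of `S`; the coordinates of the target are indexed by the points of `S`. -/
noncomputable def evalMap {n : ℕ} (d : ℕ) (S : Set (Projectivization K (Fin (n + 1) → K))) :
    MvPolynomial.homogeneousSubmodule (Fin (n + 1)) K d →ₗ[K] (S → K) where
  toFun F := fun P => MvPolynomial.eval (normRep P.1) F.1
  map_add' F G := by
    funext P
    simp
  map_smul' c F := by
    funext P
    simp [MvPolynomial.smul_eval]

end HermitianCode

/-! Write h for the sesquilinear form of H, and let F be a form of degree d ≤ q vanishing at all
isotropic vectors. Given v with h(v,v) ≠ 0, rank at least 2 yields w orthogonal to v with h(w,w) ≠ 0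
(`exists_orthogonal_nonisotropic`). Then v + tw is isotropic iff t^(q+1) = -h(v,v)/h(w,w), a
non-zero element of F_q, so for q + 1 values of t. As F(v + tw) has degree at most q in t, it is
identically zero, and t = 0 gives F(v) = 0. Thus F vanishes at every vector, and d ≤ |K| forces F =
0. -/

namespace HermitianCode

/-! ### The q-power map and norm equations -/

section Frobenius

variable {K : Type*} [Field K] [Fintype K]

/-- In a field with `q ^ 2` elements, `a ↦ a ^ q` is additive. -/
theorem add_pow_of_card_eq_sq {q : ℕ} (hq : IsPrimePow q) (hK : Fintype.card K = q ^ 2)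
    (a b : K) : (a + b) ^ q = a ^ q + b ^ q := by
  obtain ⟨p, k, hp, hk, rfl⟩ := hq
  obtain ⟨p', hchar, m, hp', hcard⟩ := FiniteField.card' K
  have hdvd : p' ∣ (p ^ k) ^ 2 := by
    rw [← hK, hcard]
    exact dvd_pow_self _ m.ne_zero
  have hpp : p' = p :=
    (Nat.prime_dvd_prime_iff_eq hp' hp.nat_prime).mp
      (hp'.dvd_of_dvd_pow (hp'.dvd_of_dvd_pow hdvd))
  subst hpp
  have := Fact.mk hp'
  exact add_pow_char_pow a b p' k

/-- In a field with `q ^ 2` elements, `a ↦ a ^ q` is an involution. -/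
theorem pow_pow_of_card_eq_sq {q : ℕ} (hK : Fintype.card K = q ^ 2) (a : K) :
    (a ^ q) ^ q = a := by
  rw [← pow_mul, ← sq, ← hK, FiniteField.pow_card]

open Polynomial in
/-- In a field with `q ^ 2` elements, a non-zero element of the subfield with `q` elements has
`q + 1` distinct `(q + 1)`-st roots. -/
theorem roots_X_pow_succ_sub_C {q : ℕ} (hq : 1 < q) (hK : Fintype.card K = q ^ 2) {c : K}
    (hc : c ≠ 0) (hcq : c ^ q = c) :
    (X ^ (q + 1) - C c : K[X]).roots.Nodup ∧
      (X ^ (q + 1) - C c : K[X]).roots.card = q + 1 := by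
  have hne : (X ^ (Fintype.card K) - X : K[X]) ≠ 0 :=
    FiniteField.X_pow_card_sub_X_ne_zero K Fintype.one_lt_card
  -- With r = q - 1, c^r = 1 and (q + 1)r = q^2 - 1, so the binomial divides X^(q^2 - 1) - 1.
  have hdvd : (X ^ (q + 1) - C c : K[X]) ∣ X ^ (Fintype.card K) - X := by
    obtain ⟨r, rfl⟩ : ∃ r, q = r + 1 := ⟨q - 1, by omega⟩
    have hcr : c ^ r = 1 := by
      rw [pow_succ] at hcq
      exact mul_right_cancel₀ hc (by rw [hcq, one_mul])
    have h := sub_dvd_pow_sub_pow (X ^ (r + 1 + 1) : K[X]) (C c) r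
    rw [← C_pow, hcr, C_1] at h
    have hX : (X ^ (Fintype.card K) - X : K[X]) = ((X ^ (r + 1 + 1)) ^ r - 1) * X := by
      rw [hK]
      ring
    rw [hX]
    exact h.mul_right _
  have hroots : (X ^ (Fintype.card K) - X : K[X]).roots = Finset.univ.val :=
    FiniteField.roots_X_pow_card_sub_X K
  have hsplits : (X ^ (Fintype.card K) - X : K[X]).Splits := by
    rw [splits_iff_card_roots, hroots,
      FiniteField.X_pow_card_sub_X_natDegree_eq K Fintype.one_lt_card]
    rfl
  refine ⟨Multiset.nodup_of_le (roots.le_of_dvd hne hdvd) (hroots ▸ Finset.univ.nodup), ?_⟩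
  rw [← (hsplits.of_dvd hne hdvd).natDegree_eq_card_roots, natDegree_X_pow_sub_C]

open Polynomial in
/-- A polynomial of degree at most `q` that vanishes at the `(q + 1)`-st roots of a non-zero element
of the subfield with `q` elements is zero. -/
theorem eq_zero_of_vanishes_on_roots {q : ℕ} (hq : 1 < q) (hK : Fintype.card K = q ^ 2) {c : K}
    (hc : c ≠ 0) (hcq : c ^ q = c) {G : K[X]} (hG : G.natDegree ≤ q)
    (h : ∀ t : K, t ^ (q + 1) = c → G.eval t = 0) : G = 0 := by
  by_contra hG0
  obtain ⟨hnodup, hcard⟩ := roots_X_pow_succ_sub_C hq hK hc hcq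
  have hle : (X ^ (q + 1) - C c : K[X]).roots ≤ G.roots := by
    rw [Multiset.le_iff_subset hnodup]
    intro t ht
    have ht' := isRoot_of_mem_roots ht
    rw [mem_roots hG0]
    exact h t (by simpa [sub_eq_zero] using ht')
  have := Multiset.card_le_card hle
  have := G.card_roots'
  omega

end Frobenius

/-! ### The sesquilinear form -/

section Form

variable {K : Type*} [Field K] {n : ℕ}

/-- The sesquilinear form `x, y ↦ xᵀ H y^(q)`. -/
def sesqForm (q : ℕ) (H : Matrix (Fin (n + 1)) (Fin (n + 1)) K) (x y : Fin (n + 1) → K) : K :=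
  ∑ i, ∑ j, H i j * x i * y j ^ q

variable {q : ℕ} {H : Matrix (Fin (n + 1)) (Fin (n + 1)) K}

theorem eval_hermitianPoly (v : Fin (n + 1) → K) :
    MvPolynomial.eval v (hermitianPoly q H) = sesqForm q H v v := by
  simp [hermitianPoly, sesqForm]

theorem sesqForm_add_left (x x' y : Fin (n + 1) → K) :
    sesqForm q H (x + x') y = sesqForm q H x y + sesqForm q H x' y := by
  simp only [sesqForm, ← Finset.sum_add_distrib]
  exact Finset.sum_congr rfl fun i _ => Finset.sum_congr rfl fun j _ => by
    rw [Pi.add_apply]; ring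

theorem sesqForm_smul_left (c : K) (x y : Fin (n + 1) → K) :
    sesqForm q H (c • x) y = c * sesqForm q H x y := by
  simp only [sesqForm, Finset.mul_sum]
  exact Finset.sum_congr rfl fun i _ => Finset.sum_congr rfl fun j _ => by
    rw [Pi.smul_apply, smul_eq_mul]; ring

theorem sesqForm_smul_right (c : K) (x y : Fin (n + 1) → K) :
    sesqForm q H x (c • y) = c ^ q * sesqForm q H x y := by
  simp only [sesqForm, Finset.mul_sum]
  exact Finset.sum_congr rfl fun i _ => Finset.sum_congr rfl fun j _ => by
    rw [Pi.smul_apply, smul_eq_mul, mul_pow]; ring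

theorem sesqForm_add_right (hadd : ∀ a b : K, (a + b) ^ q = a ^ q + b ^ q)
    (x y y' : Fin (n + 1) → K) :
    sesqForm q H x (y + y') = sesqForm q H x y + sesqForm q H x y' := by
  simp only [sesqForm, ← Finset.sum_add_distrib]
  exact Finset.sum_congr rfl fun i _ => Finset.sum_congr rfl fun j _ => by
    rw [Pi.add_apply, hadd]; ring

theorem sesqForm_single (hq : q ≠ 0) (i j : Fin (n + 1)) :
    sesqForm q H (Pi.single i 1) (Pi.single j 1) = H i j := by
  simp only [sesqForm]
  rw [Finset.sum_eq_single i, Finset.sum_eq_single j] <;> simp +contextual [hq]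

theorem sesqForm_pow (hq : q ≠ 0) (hadd : ∀ a b : K, (a + b) ^ q = a ^ q + b ^ q)
    (hinv : ∀ a : K, (a ^ q) ^ q = a) (hH : IsHermitianMatrix q H) (x y : Fin (n + 1) → K) :
    sesqForm q H x y ^ q = sesqForm q H y x := by
  have hent : ∀ i j, H i j ^ q = H j i := fun i j => by
    simpa using (congrFun (congrFun hH.2 i) j).symm
  let σ : K →+ K := ⟨⟨fun a => a ^ q, by simp [hq]⟩, hadd⟩
  change σ _ = _
  simp only [sesqForm, map_sum]
  rw [Finset.sum_comm]
  refine Finset.sum_congr rfl fun j _ => Finset.sum_congr rfl fun i _ => ?_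
  change (H i j * x i * y j ^ q) ^ q = _
  rw [mul_pow, mul_pow, hent, hinv]
  ring

end Form

/-! ### Orthogonal non-isotropic vectors -/

section Orthogonal

variable {K : Type*} [Field K] [Fintype K] {n q : ℕ} {H : Matrix (Fin (n + 1)) (Fin (n + 1)) K}

/-- In a field with `q ^ 2` elements, some element has non-zero trace to the subfield with `q`
elements. -/
theorem exists_add_pow_ne_zero (hq : 1 < q) (hK : Fintype.card K = q ^ 2) :
    ∃ a : K, a + a ^ q ≠ 0 := by
  by_contra! h
  have hne := FiniteField.X_pow_card_sub_X_ne_zero K hq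
  have hdeg : (Polynomial.X ^ q + Polynomial.X : Polynomial K).natDegree = q := by
    rw [Polynomial.natDegree_add_eq_left_of_natDegree_lt] <;> simp [hq]
  have h0 : (Polynomial.X ^ q + Polynomial.X : Polynomial K) ≠ 0 := by
    intro h0
    rw [h0, Polynomial.natDegree_zero] at hdeg
    omega
  have hcard := Polynomial.card_le_degree_of_subset_roots
    (p := (Polynomial.X ^ q + Polynomial.X : Polynomial K)) (Z := Finset.univ) (by
      intro a _
      rw [Polynomial.mem_roots h0]
      simpa [add_comm] using h a)
  rw [Finset.card_univ, hK, hdeg] at hcard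
  nlinarith

/-- If the rank of a Hermitian matrix is at least two, then every non-isotropic vector has a
non-isotropic vector orthogonal to it. -/
theorem exists_orthogonal_nonisotropic (hq : IsPrimePow q) (hK : Fintype.card K = q ^ 2)
    (hH : IsHermitianMatrix q H) (hr : 2 ≤ H.rank) {v : Fin (n + 1) → K}
    (hv : sesqForm q H v v ≠ 0) :
    ∃ w, sesqForm q H w v = 0 ∧ sesqForm q H w w ≠ 0 := by
  by_contra! hiso
  have hadd := add_pow_of_card_eq_sq hq hK
  have hsymm := sesqForm_pow hq.ne_zero hadd (pow_pow_of_card_eq_sq hK) hH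
  -- Polarization: if h(x,y) ≠ 0, rescale x so that h(x,y) = a has non-zero trace; then h(x+y,x+y) =
  -- a + a^q ≠ 0.
  have hzero : ∀ x y, sesqForm q H x v = 0 → sesqForm q H y v = 0 → sesqForm q H x y = 0 := by
    intro x y hx hy
    by_contra hxy
    obtain ⟨a, ha⟩ := exists_add_pow_ne_zero hq.one_lt hK
    set b := a * (sesqForm q H x y)⁻¹ with hb
    have hbx : sesqForm q H (b • x) v = 0 := by rw [sesqForm_smul_left, hx, mul_zero]
    have hbxy : sesqForm q H (b • x) y = a := by
      rw [sesqForm_smul_left, hb, inv_mul_cancel_right₀ hxy]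
    have hsum : sesqForm q H (b • x + y) (b • x + y) = 0 :=
      hiso _ (by rw [sesqForm_add_left, hbx, hy, add_zero])
    rw [sesqForm_add_left, sesqForm_add_right hadd, sesqForm_add_right hadd, hiso _ hbx,
      hiso _ hy, ← hsymm (b • x) y, hbxy, zero_add, add_zero] at hsum
    exact ha hsum
  have hproj : ∀ x, sesqForm q H (x + (-(sesqForm q H x v / sesqForm q H v v)) • v) v = 0 := by
    intro x
    rw [sesqForm_add_left, sesqForm_smul_left]
    field_simp
    ring
  -- The orthogonal complement of v lies in the radical, so h factors through the projection to v
  -- and H has rank at most 1.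
  have hleft : ∀ x y, sesqForm q H x v = 0 → sesqForm q H x y = 0 := by
    intro x y hx
    have h := hzero x _ hx (hproj y)
    rwa [sesqForm_add_right hadd, sesqForm_smul_right, hx, mul_zero, add_zero] at h
  have hrank_one : H = Matrix.vecMulVec
      (fun i => sesqForm q H (Pi.single i 1) v / sesqForm q H v v)
      (fun j => sesqForm q H v (Pi.single j 1)) := by
    ext i j
    have h := hleft _ (Pi.single j 1) (hproj (Pi.single i 1))
    rw [sesqForm_add_left, sesqForm_smul_left, sesqForm_single hq.ne_zero] at h
    rw [Matrix.vecMulVec_apply]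
    linear_combination h
  have := Matrix.rank_vecMulVec_le
      (fun i => sesqForm q H (Pi.single i 1) v / sesqForm q H v v)
      (fun j => sesqForm q H v (Pi.single j 1))
  rw [← hrank_one] at this
  omega

end Orthogonal

/-! ### Vanishing on isotropic vectors -/

section Evaluation

variable {K : Type*} [Field K] {n : ℕ}

theorem IsHomogeneous.eval_smul {F : MvPolynomial (Fin (n + 1)) K} {d : ℕ}
    (hF : F.IsHomogeneous d) (c : K) (v : Fin (n + 1) → K) :
    MvPolynomial.eval (c • v) F = c ^ d * MvPolynomial.eval v F := by
  simp only [MvPolynomial.eval_eq, Finset.mul_sum]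
  refine Finset.sum_congr rfl fun m hm => ?_
  have hdeg : ∑ i, m i = d := by
    rw [← Finsupp.degree_eq_sum, Finsupp.degree_eq_weight_one]
    exact hF (MvPolynomial.mem_support_iff.mp hm)
  simp only [Pi.smul_apply, smul_eq_mul, mul_pow, Finset.prod_mul_distrib]
  rw [← hdeg, Finset.prod_subset (Finset.subset_univ m.support), Finset.prod_pow_eq_pow_sum]
  · ring
  · intro i _ hi
    simp [Finsupp.notMem_support_iff.mp hi]

/-- Assuming only the scaling law lets this apply to `hermitianPoly` directly through
sesquilinearity. -/
theorem vanishesAt_mk_iff {F : MvPolynomial (Fin (n + 1)) K}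
    {d : ℕ} (hF : ∀ (c : K) v, MvPolynomial.eval (c • v) F = c ^ d * MvPolynomial.eval v F)
    {v : Fin (n + 1) → K} (hv : v ≠ 0) :
    VanishesAt F (Projectivization.mk K v hv) ↔ MvPolynomial.eval v F = 0 := by
  refine ⟨fun h => h v hv rfl, fun h w hw hwv => ?_⟩
  rw [Projectivization.mk_eq_mk_iff'] at hwv
  obtain ⟨a, rfl⟩ := hwv
  rw [hF, h, mul_zero]

theorem mk_mem_hermitianPoints_iff {q : ℕ} {H : Matrix (Fin (n + 1)) (Fin (n + 1)) K}
    {v : Fin (n + 1) → K} (hv : v ≠ 0) :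
    Projectivization.mk K v hv ∈ hermitianPoints q H ↔ sesqForm q H v v = 0 := by
  rw [← eval_hermitianPoly]
  refine vanishesAt_mk_iff (d := q + 1) (fun c w => ?_) hv
  rw [eval_hermitianPoly, eval_hermitianPoly, sesqForm_smul_left, sesqForm_smul_right]
  ring

theorem eq_zero_of_vanishes_on_isotropic [Fintype K] {q d : ℕ} (hq : IsPrimePow q)
    (hK : Fintype.card K = q ^ 2) (hd : d ≤ q) {H : Matrix (Fin (n + 1)) (Fin (n + 1)) K}
    (hH : IsHermitianMatrix q H) (hr : 2 ≤ H.rank) {F : MvPolynomial (Fin (n + 1)) K}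
    (hF : F.IsHomogeneous d)
    (h : ∀ v : Fin (n + 1) → K, v ≠ 0 → sesqForm q H v v = 0 → MvPolynomial.eval v F = 0) :
    F = 0 := by
  have hadd := add_pow_of_card_eq_sq hq hK
  have hsymm := sesqForm_pow hq.ne_zero hadd (pow_pow_of_card_eq_sq hK) hH
  have hne : ∀ v : Fin (n + 1) → K, v ≠ 0 → MvPolynomial.eval v F = 0 := by
    intro v hv0
    by_cases hv : sesqForm q H v v = 0
    · exact h v hv0 hv
    obtain ⟨w, hwv, hww⟩ := exists_orthogonal_nonisotropic hq hK hH hr hv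
    have hvw : sesqForm q H v w = 0 := by rw [← hsymm, hwv, zero_pow hq.ne_zero]
    -- The restriction of `F` to the line through `v` and `w`.
    set G : Polynomial K := MvPolynomial.aeval
      (fun i => Polynomial.C (w i) * Polynomial.X + Polynomial.C (v i)) F with hGdef
    have hGeval : ∀ t, G.eval t = MvPolynomial.eval (v + t • w) F := by
      intro t
      rw [hGdef, ← Polynomial.coe_evalRingHom, MvPolynomial.aeval_def,
        MvPolynomial.hom_eval₂, MvPolynomial.eval, MvPolynomial.coe_eval₂Hom]
      congr 1
      · ext a
        exact Polynomial.eval_C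
      · funext i
        change Polynomial.eval t (Polynomial.C (w i) * Polynomial.X + Polynomial.C (v i)) =
          v i + t * w i
        rw [Polynomial.eval_add, Polynomial.eval_mul, Polynomial.eval_C, Polynomial.eval_C,
          Polynomial.eval_X]
        ring
    have hGdeg : G.natDegree ≤ q := by
      refine (MvPolynomial.aeval_natDegree_le F hF.totalDegree_le _
        (fun i => Polynomial.natDegree_linear_le)).trans ?_
      rwa [mul_one]
    have hG : G = 0 := by
      refine eq_zero_of_vanishes_on_roots hq.one_lt hK
        (c := -(sesqForm q H v v) / sesqForm q H w w) (div_ne_zero (neg_ne_zero.mpr hv) hww)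
        ?_ hGdeg ?_
      · have hneg : (-(sesqForm q H v v)) ^ q = -(sesqForm q H v v) := by
          have h0 := hadd (-(sesqForm q H v v)) (sesqForm q H v v)
          rw [neg_add_cancel, zero_pow hq.ne_zero, hsymm] at h0
          exact eq_neg_of_add_eq_zero_left h0.symm
        rw [div_pow, hsymm, hneg]
      · intro t ht
        rw [hGeval]
        apply h
        -- v + tw ≠ 0, since its pairing with v is h(v,v).
        · intro h0
          apply hv
          have : sesqForm q H (v + t • w) v = 0 := by
            rw [h0, ← zero_smul K v, sesqForm_smul_left, zero_mul]
          rwa [sesqForm_add_left, sesqForm_smul_left, hwv, mul_zero, add_zero] at this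
        · rw [sesqForm_add_left, sesqForm_add_right hadd, sesqForm_add_right hadd,
            sesqForm_smul_left, sesqForm_smul_left, sesqForm_smul_right, sesqForm_smul_right,
            hwv, hvw]
          rw [eq_div_iff hww] at ht
          linear_combination ht
    have h0 := hGeval 0
    rwa [hG, Polynomial.eval_zero, zero_smul, add_zero, eq_comm] at h0
  refine hF.eq_zero_of_forall_eval_eq_zero_of_le_card (fun v => ?_) ?_
  -- Writing the origin as 0 times a non-zero vector also covers d = 0, where 0^d = 1.
  · by_cases hv : v = 0
    · have h1 : (Pi.single 0 1 : Fin (n + 1) → K) ≠ 0 := by simp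
      rw [hv, ← zero_smul K (Pi.single 0 1 : Fin (n + 1) → K), IsHomogeneous.eval_smul hF,
        hne _ h1, mul_zero]
    · exact hne v hv
  · rw [Cardinal.mk_fintype, hK]
    exact_mod_cast hd.trans (Nat.le_self_pow two_ne_zero q)

end Evaluation

end HermitianCode

open HermitianCode in
theorem mainTheorem11 {K : Type*} [Field K] [Fintype K] (q : ℕ) (hq : IsPrimePow q)
    (hK : Fintype.card K = q ^ 2) (n : ℕ) (hn : 3 ≤ n) (d : ℕ) (hd : d ≤ q)
    (H : Matrix (Fin (n + 1)) (Fin (n + 1)) K) (hH : IsHermitianMatrix q H) (hr : H.rank = n) :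
    Function.Injective (evalMap d (hermitianPoints q H)) ∧
      ∀ F : MvPolynomial (Fin (n + 1)) K, F.IsHomogeneous d → F ≠ 0 →
        ∃ P ∈ hermitianPoints q H, ¬ VanishesAt F P := by
  have hrank : 2 ≤ H.rank := by omega
  constructor
  · rw [injective_iff_map_eq_zero]
    rintro ⟨F, hF⟩ hFz
    have hhom : F.IsHomogeneous d := hF
    rw [Submodule.mk_eq_zero]
    refine eq_zero_of_vanishes_on_isotropic hq hK hd hH hrank hhom fun v hv hvH => ?_
    set P := Projectivization.mk K v hv with hP
    have hmem : P ∈ hermitianPoints q H := (mk_mem_hermitianPoints_iff hv).mpr hvH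
    have hval : MvPolynomial.eval (normRep P) F = 0 := congrFun hFz ⟨P, hmem⟩
    -- Homogeneity carries vanishing from the normalized vector to all representatives.
    obtain ⟨-, hu, huP⟩ := (existsUnique_normalized P).choose_spec.1
    have hvan : VanishesAt F P := by
      rw [← huP]
      exact (vanishesAt_mk_iff (IsHomogeneous.eval_smul hhom) hu).mpr hval
    exact hvan v hv rfl
  · intro F hF hF0
    by_contra! hall
    exact hF0 (eq_zero_of_vanishes_on_isotropic hq hK hd hH hrank hF fun v hv hvH =>
      hall _ ((mk_mem_hermitianPoints_iff hv).mpr hvH) v hv rfl)
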